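/- For $n\ge 1$, cars $1,\dots,n$ arrive one at a time at a one-way street with spaces $1,\dots,n$; car $i$ has preferred space $\pi_i\in\{1,\dots,n\}$ and parks in the first free space numbered at least $\pi_i$, if there is one (otherwise it leaves). The sequence $\pi=(\pi_1,\dots,\pi_n)$ is a parking function if all $n$ cars are able to park; it then yields a permutation $\sigma=T_n(\pi)\in S_n$, where $\sigma_s$ is the number of the car that parks in space $s$, so that $\sigma^{-1}_k$ is the space in which car $k$ parks. Let $P_n^{\mathrm{park}}$ be the distribution of $T_n(\pi)$ on $S_n$ when $\pi$ is uniformly distributed on the set of parking functions of length $n$. The Borel distribution is the probability distribution on $\{1,2,\dots\}$ with weights $e^{-m}\frac{m^{m-1}}{m!}$, $m\ge1$. Let $j\in\mathbb N$. As $n\to\infty$ (with $n\ge j$), the random vector $$(n+1-\sigma^{-1}_{n-j+1},\ n+1-\sigma^{-1}_{n-j+2},\ \dots,\ n+1-\sigma^{-1}_n)$$ under $P_n^{\mathrm{park}}$ converges in distribution to $$\Big(\sum_{r=1}^jX_r,\ \sum_{r=2}^jX_r,\ \dots,\ X_{j-1}+X_j,\ X_j\Big),$$ where $X_1,\dots,X_j$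 are independent and identically distributed with the Borel distribution. In particular, for every $j\in\mathbb N$, the last $j$ of the $n$ cars park in increasing order with probability tending to $1$: $$\lim_{n\to\infty}P_n^{\mathrm{park}}\big(\sigma^{-1}_{n-j+1}<\sigma^{-1}_{n-j+2}<\cdots<\sigma^{-1}_n\big)=1.$$ -/

import Mathlib

open MeasureTheory ProbabilityTheory Filter Topology

noncomputable section

namespace Parking

/-! Cars and spaces are both indexed by `Fin n`: the element `i : Fin n` stands for car
(or space) number `i + 1`. -/

/-- The first space at or after `p` that is not in the set `occ` of occupied spaces;
`⊤` if there is none, i.e. if the car has to leave the street. -/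
def firstFree {n : ℕ} (occ : Finset (Fin n)) (p : Fin n) : WithTop (Fin n) :=
  (Finset.univ.filter fun s : Fin n => p ≤ s ∧ s ∉ occ).min

/-- The set of spaces that are occupied after the first `m` cars have arrived. -/
def occupied {n : ℕ} (π : Fin n → Fin n) : ℕ → Finset (Fin n)
  | 0 => ∅
  | m + 1 => Finset.univ.filter fun s : Fin n =>
      s ∈ occupied π m ∨ ∃ h : m < n, firstFree (occupied π m) (π ⟨m, h⟩) = (s : WithTop (Fin n))

/-- The space in which car `i` parks (`⊤` if it is unable to park). -/
def spot {n : ℕ} (π : Fin n → Fin n) (i : Fin n) : WithTop (Fin n) :=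
  firstFree (occupied π i) (π i)

/-- A preference sequence is a parking function if all cars are able to park. -/
def IsParkingFunction {n : ℕ} (π : Fin n → Fin n) : Prop :=
  ∀ i, spot π i ≠ ⊤

/-- The set of parking functions, as a type. -/
abbrev ParkingFunction (n : ℕ) : Type :=
  {π : Fin n → Fin n // IsParkingFunction π}

instance (n : ℕ) : Fintype (ParkingFunction n) := Fintype.ofFinite _

theorem firstFree_eq_coe {n : ℕ} {occ : Finset (Fin n)} {p s : Fin n}
    (h : firstFree occ p = (s : WithTop (Fin n))) : p ≤ s ∧ s ∉ occ := by
  simpa using Finset.mem_of_min h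

theorem occupied_mono {n : ℕ} (π : Fin n → Fin n) : Monotone (occupied π) := by
  refine monotone_nat_of_le_succ fun m s hs => ?_
  simp [occupied, hs]

theorem mem_occupied_of_spot {n : ℕ} {π : Fin n → Fin n} {i s : Fin n}
    (h : spot π i = (s : WithTop (Fin n))) {m : ℕ} (hm : (i : ℕ) < m) : s ∈ occupied π m := by
  refine occupied_mono π (Nat.succ_le_of_lt hm) ?_
  simp only [occupied, Finset.mem_filter, Finset.mem_univ, true_and]
  exact Or.inr ⟨i.2, h⟩

/-- The space in which each car parks, for a parking function. -/
def parkedAt {n : ℕ} (π : ParkingFunction n) (i : Fin n) : Fin n :=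
  (spot π.1 i).untop (π.2 i)

theorem coe_parkedAt {n : ℕ} (π : ParkingFunction n) (i : Fin n) :
    (parkedAt π i : WithTop (Fin n)) = spot π.1 i :=
  WithTop.coe_untop _ _

theorem parkedAt_injective {n : ℕ} (π : ParkingFunction n) :
    Function.Injective (parkedAt π) := by
  have key : ∀ i k : Fin n, i < k → parkedAt π i ≠ parkedAt π k := by
    intro i k hik heq
    have h1 := mem_occupied_of_spot (coe_parkedAt π i).symm (m := (k : ℕ)) hik
    have h2 := (firstFree_eq_coe (coe_parkedAt π k).symm).2
    exact h2 (heq ▸ h1)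
  intro i k h
  rcases lt_trichotomy i k with hlt | heq | hgt
  · exact absurd h (key i k hlt)
  · exact heq
  · exact absurd h.symm (key k i hgt)

/-- The permutation `σ` of a parking function: `σ s` is the car that parks in space `s`. -/
def parkPerm {n : ℕ} (π : ParkingFunction n) : Equiv.Perm (Fin n) :=
  (Equiv.ofBijective (parkedAt π) (Finite.injective_iff_bijective.1 (parkedAt_injective π))).symm

theorem occupied_id {n : ℕ} (m : ℕ) :
    occupied (id : Fin n → Fin n) m = Finset.univ.filter fun s : Fin n => (s : ℕ) < m := by
  induction m with
  | zero => simp [occupied]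
  | succ m ih =>
    ext s
    have hf : ∀ h : m < n, firstFree (occupied (id : Fin n → Fin n) m) ⟨m, h⟩
        = ((⟨m, h⟩ : Fin n) : WithTop (Fin n)) := by
      intro h
      refine le_antisymm (Finset.min_le (by simp [ih])) (Finset.le_min fun b hb => ?_)
      have := (Finset.mem_filter.1 hb).2.1
      exact_mod_cast this
    simp only [occupied, Finset.mem_filter, Finset.mem_univ, true_and, id]
    constructor
    · rintro (h | ⟨h, h'⟩)
      · rw [ih] at h
        have := (Finset.mem_filter.1 h).2
        omega
      · rw [hf h] at h'
        have := WithTop.coe_injective h'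
        subst this
        simp
    · intro h
      rcases Nat.lt_succ_iff_lt_or_eq.1 h with h | h
      · left
        simp [ih, h]
      · right
        subst h
        exact ⟨s.2, hf s.2⟩

theorem isParkingFunction_id (n : ℕ) : IsParkingFunction (id : Fin n → Fin n) := by
  intro i h
  rw [spot, firstFree] at h
  have h' := Finset.min_eq_top.1 h
  have : i ∈ (∅ : Finset (Fin n)) := by
    rw [← h']
    simp [occupied_id]
  simp at this

instance (n : ℕ) : Nonempty (ParkingFunction n) := ⟨⟨id, isParkingFunction_id n⟩⟩

instance (n : ℕ) : MeasurableSpace (Equiv.Perm (Fin n)) := ⊤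

/-- The distribution on permutations that is induced by a uniformly random parking function. -/
def parkMeasure (n : ℕ) : Measure (Equiv.Perm (Fin n)) :=
  ((PMF.uniformOfFintype (ParkingFunction n)).map parkPerm).toMeasure

instance (n : ℕ) : IsProbabilityMeasure (parkMeasure n) :=
  inferInstanceAs (IsProbabilityMeasure (PMF.toMeasure _))

/-- The `l`-th (counted from `0`) of the last `j` among `n` cars; its number is `n - j + l + 1`. -/
def lastCar {j n : ℕ} (h : j ≤ n) (l : Fin j) : Fin n :=
  ⟨n - j + l, by omega⟩

/-- The number in `{1, …, n}` of the space in which car `i` parks, i.e. `σ⁻¹` at this car. -/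
def position {n : ℕ} (σ : Equiv.Perm (Fin n)) (i : Fin n) : ℕ :=
  (σ⁻¹ i : Fin n) + 1

/-- The weights of the Borel distribution on `{1, 2, …}`. -/
def borelWeight (m : ℕ) : ℝ :=
  if m = 0 then 0 else Real.exp (-(m : ℝ)) * (m : ℝ) ^ (m - 1) / (m.factorial : ℝ)

/-- The Borel distribution. -/
def borelMeasure : Measure ℕ :=
  Measure.sum fun m : ℕ => ENNReal.ofReal (borelWeight m) • Measure.dirac m

end Parking

end

noncomputable section

namespace Parking

/-! ### Abel's binomial identity -/

/-! Fix increasing spaces `e 0 < … < e (j - 1)` for the last `j` cars. The first `n - j` cars must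
fill the complement. When the `l`-th of the last cars arrives, `e l` is the smallest free space, so
exactly its `e l + 1` preferences at or below `e l` succeed (`fillsInOrder_succ_iff`). Filling the
complement is counted by `outcomeCount`, which splits at free spaces into a binomial coefficient
times counts of the parts (`outcomeCount_union`), while a full run of length `m` contributes `(m +
1) ^ (m - 1)` (`outcomeCount_range`, via Abel's identity).

Let the blocks starting at the free spaces have fixed lengths `x r`, and let the initial run of
length `k` grow. After division by the number `(n + 1) ^ (n - 1)` of parking functions, the initial
run supplies the factor `e ^ (-∑ x r)` in the limit and each block supplies `x ^ (x - 2) / (x - 1)!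
= x ^ (x - 1) / x!`. The limit is the product of the Borel weights
(`tendsto_outcomeCount_blockSet`).

Lower bounds for these point masses suffice. The limits sum to one, so no mass is left for other
outcomes, such as cars parking out of order. This makes `hasSum_borelWeight` essential; it follows
from Abel's identity by a renewal argument. A Fatou argument (`pi_borelMeasure_le_liminf`) and the
portmanteau theorem then give both claims. -/

theorem alternating_sum_choose_mul_pow (N : ℕ) :
    ∑ k ∈ Finset.range (N + 2), (-1 : ℝ) ^ (N + 1 - k) * ((N + 1).choose k : ℝ) * ((k : ℝ) + 1) ^ N
      = 0 := by
  have h := congrFun (fwdDiff_iter_pow_eq_zero_of_lt (R := ℝ) (Nat.lt_succ_self N)) 1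
  rw [fwdDiff_iter_eq_sum_shift] at h
  rw [Pi.zero_apply] at h
  rw [← h]
  refine Finset.sum_congr rfl fun k _ => ?_
  simp [zsmul_eq_mul, add_comm]

/-- Abel's binomial identity (with first parameter `1`). -/
theorem abel_identity (N : ℕ) (y : ℝ) :
    ∑ k ∈ Finset.range (N + 1),
      (N.choose k : ℝ) * ((k : ℝ) + 1) ^ (k - 1) * (y + (N - k : ℕ)) ^ (N - k)
      = (y + N + 1) ^ N := by
  induction N generalizing y with
  | zero => simp
  | succ N ih =>
    set F : ℝ → ℝ := fun y => ∑ k ∈ Finset.range (N + 2),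
      ((N + 1).choose k : ℝ) * ((k : ℝ) + 1) ^ (k - 1) * (y + (N + 1 - k : ℕ)) ^ (N + 1 - k)
      with hF
    -- Differentiating in `y` turns the sum for `N + 1` into `N + 1` times the sum for `N` at `y +
    -- 1`, where the induction hypothesis applies.
    have hFd : ∀ y, HasDerivAt F ((N + 1) * (y + 1 + N + 1) ^ N) y := by
      intro y
      rw [← ih (y + 1), Finset.mul_sum]
      have h1 : HasDerivAt F (∑ k ∈ Finset.range (N + 2),
          ((N + 1).choose k : ℝ) * ((k : ℝ) + 1) ^ (k - 1) *
            (((N + 1 - k : ℕ) : ℝ) * (y + (N + 1 - k : ℕ)) ^ (N + 1 - k - 1) * 1)) y := by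
        refine HasDerivAt.fun_sum fun k _ => ?_
        exact (((hasDerivAt_id y).add_const _).pow _).const_mul _
      convert h1 using 1
      rw [Finset.sum_range_succ _ (N + 1)]
      simp only [Nat.sub_self, Nat.cast_zero, zero_mul, mul_zero, add_zero]
      refine Finset.sum_congr rfl fun k hk => ?_
      have hk' : k ≤ N := Nat.lt_succ_iff.1 (Finset.mem_range.1 hk)
      have e1 : N + 1 - k = (N - k) + 1 := by omega
      have e2 : ((N : ℝ) + 1) * (N.choose k : ℝ) =
          ((N + 1).choose k : ℝ) * ((N + 1 - k : ℕ) : ℝ) := by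
        rw [mul_comm]
        exact_mod_cast Nat.choose_mul_succ_eq N k
      rw [show ((N : ℝ) + 1) * ((N.choose k : ℝ) * ((k : ℝ) + 1) ^ (k - 1) *
        (y + 1 + (N - k : ℕ)) ^ (N - k)) = ((N : ℝ) + 1) * (N.choose k : ℝ) *
        (((k : ℝ) + 1) ^ (k - 1) * (y + 1 + (N - k : ℕ)) ^ (N - k)) by ring, e2, e1]
      push_cast
      ring
    have hGd : ∀ y : ℝ, HasDerivAt (fun y : ℝ => (y + (N + 1 : ℕ) + 1) ^ (N + 1))
        ((N + 1) * (y + 1 + N + 1) ^ N) y := by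
      intro y
      refine ((((hasDerivAt_id y).add_const ((N + 1 : ℕ) : ℝ)).add_const 1).fun_pow
        (N + 1)).congr_deriv ?_
      simp only [id, Nat.add_sub_cancel]
      push_cast
      ring
    -- Both sides have the same derivative, so one point suffices. At `y = -(N + 2)` the right side
    -- vanishes, and every base on the left becomes `-(k + 1)`, which leaves an `(N + 1)`-st finite
    -- difference of a polynomial of degree `N`.
    have hconst := is_const_of_deriv_eq_zero (f := fun y => F y - (y + (N + 1 : ℕ) + 1) ^ (N + 1))
      (fun y => ((hFd y).fun_sub (hGd y)).differentiableAt)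
      (fun y => by rw [((hFd y).fun_sub (hGd y)).deriv]; ring) y (-((N : ℝ) + 2))
    have hzero : F (-((N : ℝ) + 2)) = 0 := by
      rw [hF, ← alternating_sum_choose_mul_pow N]
      refine Finset.sum_congr rfl fun k hk => ?_
      have hk' : k ≤ N + 1 := Nat.lt_succ_iff.1 (Finset.mem_range.1 hk)
      have e1 : -((N : ℝ) + 2) + ((N + 1 - k : ℕ) : ℝ) = (-1) * ((k : ℝ) + 1) := by
        rw [Nat.cast_sub hk']; push_cast; ring
      rw [e1, mul_pow]
      rcases Nat.eq_zero_or_pos k with rfl | hpos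
      · simp
      · rw [show ((k : ℝ) + 1) ^ N = ((k : ℝ) + 1) ^ (k - 1) * ((k : ℝ) + 1) ^ (N + 1 - k) by
          rw [← pow_add]; congr 1; omega]
        ring
    have hval : (-((N : ℝ) + 2) + ((N + 1 : ℕ) : ℝ) + 1) = 0 := by push_cast; ring
    simp only [hzero, hval] at hconst
    rw [zero_pow (Nat.succ_ne_zero N), sub_zero, sub_eq_zero] at hconst
    exact hconst

theorem sum_choose_mul_pow_mul_pow (n : ℕ) :
    ∑ k ∈ Finset.range (n + 1), n.choose k * (k + 1) ^ (k - 1) * (n - k + 1) ^ (n - k)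
      = (n + 2) ^ n := by
  have h := abel_identity n 1
  have : ((∑ k ∈ Finset.range (n + 1), n.choose k * (k + 1) ^ (k - 1) * (n - k + 1) ^ (n - k) : ℕ)
      : ℝ) = (((n + 2) ^ n : ℕ) : ℝ) := by
    push_cast
    rw [show (n : ℝ) + 2 = 1 + n + 1 by ring, ← h]
    refine Finset.sum_congr rfl fun k _ => ?_
    rw [add_comm (1 : ℝ)]
  exact_mod_cast this

/-! ### Counting preference sequences by the final set of occupied spaces -/

/-- The number of preferences that lead to space `u` when exactly the other elements of `U`
are occupied. -/
def runLength (U : Finset ℕ) (u : ℕ) : ℕ :=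
  ((Finset.range (u + 1)).filter fun p => Finset.Icc p u ⊆ U).card

/-- Auxiliary function for `outcomeCount`, by recursion on the number of cars. -/
def outcomeCountAux : ℕ → Finset ℕ → ℕ
  | 0, _ => 1
  | m + 1, U => ∑ u ∈ U, runLength U u * outcomeCountAux m (U.erase u)

/-- The number of preference sequences of `U.card` cars, arriving at an infinite street, for
which the set of occupied spaces is `U` in the end. -/
def outcomeCount (U : Finset ℕ) : ℕ := outcomeCountAux U.card U

@[simp]
theorem outcomeCount_empty : outcomeCount ∅ = 1 := rfl

theorem outcomeCount_eq_sum {U : Finset ℕ} (hU : U.Nonempty) :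
    outcomeCount U = ∑ u ∈ U, runLength U u * outcomeCount (U.erase u) := by
  obtain ⟨m, hm⟩ : ∃ m, U.card = m + 1 := ⟨U.card - 1, by have := hU.card_pos; omega⟩
  rw [outcomeCount, hm, outcomeCountAux]
  refine Finset.sum_congr rfl fun u hu => ?_
  rw [outcomeCount, Finset.card_erase_of_mem hu, hm, Nat.add_sub_cancel]

theorem runLength_congr {U V : Finset ℕ} {u : ℕ}
    (h : ∀ p ≤ u, Finset.Icc p u ⊆ U ↔ Finset.Icc p u ⊆ V) : runLength U u = runLength V u := by
  unfold runLength
  congr 1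
  refine Finset.filter_congr fun p hp => h p (Nat.lt_succ_iff.1 (Finset.mem_range.1 hp))

theorem runLength_union_left {U V : Finset ℕ} {s u : ℕ} (hV : ∀ v ∈ V, s < v) (hu : u < s) :
    runLength (U ∪ V) u = runLength U u := by
  refine runLength_congr fun p _ => ⟨fun h x hx => ?_, fun h => h.trans Finset.subset_union_left⟩
  rcases Finset.mem_union.1 (h hx) with h' | h'
  · exact h'
  · have := hV x h'
    have := (Finset.mem_Icc.1 hx).2
    omega

theorem runLength_union_right {U V : Finset ℕ} {s v : ℕ} (hU : ∀ u ∈ U, u < s)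
    (hV : ∀ v ∈ V, s < v) (hv : s < v) : runLength (U ∪ V) v = runLength V v := by
  refine runLength_congr fun p _ => ⟨fun h x hx => ?_, fun h => h.trans Finset.subset_union_right⟩
  rcases Finset.mem_union.1 (h hx) with hmem | hmem
  · have h1 := hU x hmem
    have h2 := Finset.mem_Icc.1 hx
    -- A run ending at `v` that meets `U` would have to cross the free space `s`.
    have hs : s ∈ U ∪ V := h (Finset.mem_Icc.2 ⟨by omega, hv.le⟩)
    rcases Finset.mem_union.1 hs with h3 | h3
    · exact absurd (hU s h3) (lt_irrefl s)
    · exact absurd (hV s h3) (lt_irrefl s)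
  · exact hmem

/-- Two groups of spaces that are separated by a free space do not interact. -/
theorem outcomeCount_union {U V : Finset ℕ} {s : ℕ} (hU : ∀ u ∈ U, u < s) (hV : ∀ v ∈ V, s < v) :
    outcomeCount (U ∪ V)
      = (U.card + V.card).choose U.card * outcomeCount U * outcomeCount V := by
  induction hm : U.card + V.card using Nat.strong_induction_on generalizing U V with
  | _ m ih =>
  subst hm
  rcases U.eq_empty_or_nonempty with rfl | hUn
  · simp
  rcases V.eq_empty_or_nonempty with rfl | hVn
  · simp
  have hdisj : Disjoint U V := Finset.disjoint_left.2 fun x h1 h2 =>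
    lt_asymm (hU x h1) (hV x h2)
  obtain ⟨a, ha⟩ : ∃ a, U.card = a + 1 := ⟨U.card - 1, by have := hUn.card_pos; omega⟩
  obtain ⟨b, hb⟩ : ∃ b, V.card = b + 1 := ⟨V.card - 1, by have := hVn.card_pos; omega⟩
  rw [outcomeCount_eq_sum (hUn.mono Finset.subset_union_left), Finset.sum_union hdisj]
  have h1 : ∀ u ∈ U, runLength (U ∪ V) u * outcomeCount ((U ∪ V).erase u)
      = (a + (b + 1)).choose a * outcomeCount V * (runLength U u * outcomeCount (U.erase u)) := by
    intro u hu
    have hcard : (U.erase u).card = a := by rw [Finset.card_erase_of_mem hu, ha]; rfl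
    rw [runLength_union_left hV (hU u hu), Finset.erase_union_distrib,
      Finset.erase_eq_of_notMem (Finset.disjoint_left.1 hdisj hu),
      ih _ (by omega) (fun x hx => hU x (Finset.mem_of_mem_erase hx)) hV rfl, hcard, hb]
    ring
  have h2 : ∀ v ∈ V, runLength (U ∪ V) v * outcomeCount ((U ∪ V).erase v)
      = (a + 1 + b).choose (a + 1) * outcomeCount U *
        (runLength V v * outcomeCount (V.erase v)) := by
    intro v hv
    have hcard : (V.erase v).card = b := by rw [Finset.card_erase_of_mem hv, hb]; rfl
    rw [runLength_union_right hU hV (hV v hv), Finset.erase_union_distrib,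
      Finset.erase_eq_of_notMem (Finset.disjoint_right.1 hdisj hv),
      ih _ (by omega) hU (fun x hx => hV x (Finset.mem_of_mem_erase hx)) rfl, hcard, ha]
    ring
  -- The last car parks in `U` or in `V`; the two resulting binomial coefficients add up by Pascal's
  -- rule.
  rw [Finset.sum_congr rfl h1, Finset.sum_congr rfl h2, ← Finset.mul_sum, ← Finset.mul_sum,
    ← outcomeCount_eq_sum hUn, ← outcomeCount_eq_sum hVn, ha, hb,
    show a + 1 + (b + 1) = (a + (b + 1)) + 1 by ring, Nat.choose_succ_succ,
    show a + 1 + b = a + (b + 1) by ring]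
  ring

theorem runLength_map_add (U : Finset ℕ) (t u : ℕ) :
    runLength (U.map (addRightEmbedding t)) (u + t) = runLength U u := by
  unfold runLength
  symm
  refine Finset.card_bij (fun p _ => p + t) ?_ (fun p _ q _ h => by simpa using h) ?_
  · intro p hp
    obtain ⟨hp1, hp2⟩ := Finset.mem_filter.1 hp
    rw [Finset.mem_range] at hp1
    refine Finset.mem_filter.2 ⟨Finset.mem_range.2 (by omega), fun x hx => ?_⟩
    rw [Finset.mem_Icc] at hx
    refine Finset.mem_map.2 ⟨x - t, hp2 (Finset.mem_Icc.2 (by omega)), ?_⟩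
    simp only [addRightEmbedding_apply]
    omega
  · intro q hq
    obtain ⟨hq1, hq2⟩ := Finset.mem_filter.1 hq
    rw [Finset.mem_range] at hq1
    -- The run contains its left end `q`, so `q` lies in the translate and no preference below `t`
    -- occurs.
    obtain ⟨p, -, hp⟩ := Finset.mem_map.1 (hq2 (Finset.left_mem_Icc.2 (by omega)))
    simp only [addRightEmbedding_apply] at hp
    subst hp
    refine ⟨p, Finset.mem_filter.2 ⟨Finset.mem_range.2 (by omega), fun x hx => ?_⟩, rfl⟩
    rw [Finset.mem_Icc] at hx
    obtain ⟨y, hy, hyx⟩ := Finset.mem_map.1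
      (hq2 (Finset.mem_Icc.2 (⟨by omega, by omega⟩ : p + t ≤ x + t ∧ x + t ≤ u + t)))
    simp only [addRightEmbedding_apply] at hyx
    obtain rfl : y = x := by omega
    exact hy

theorem outcomeCount_map_add (U : Finset ℕ) (t : ℕ) :
    outcomeCount (U.map (addRightEmbedding t)) = outcomeCount U := by
  induction hm : U.card generalizing U with
  | zero => rw [Finset.card_eq_zero.1 hm]; simp
  | succ m ih =>
    have hU : U.Nonempty := Finset.card_pos.1 (by omega)
    rw [outcomeCount_eq_sum (hU.map), outcomeCount_eq_sum hU, Finset.sum_map]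
    refine Finset.sum_congr rfl fun u hu => ?_
    rw [← Finset.map_erase, ih _ (by rw [Finset.card_erase_of_mem hu, hm]; rfl),
      addRightEmbedding_apply, runLength_map_add]

theorem runLength_range {n s : ℕ} (hs : s < n) : runLength (Finset.range n) s = s + 1 := by
  unfold runLength
  rw [Finset.filter_true_of_mem, Finset.card_range]
  intro p _ x hx
  rw [Finset.mem_Icc] at hx
  exact Finset.mem_range.2 (by omega)

/-- There are `(n + 1) ^ (n - 1)` parking functions of length `n`. -/
theorem outcomeCount_range (n : ℕ) : outcomeCount (Finset.range n) = (n + 1) ^ (n - 1) := by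
  induction n using Nat.strong_induction_on with
  | _ n ih =>
  rcases n with _ | n
  · simp
  -- The last car parks in some space and splits the rest into two full runs. After reflection, the
  -- summation index is the number of spaces to its right, as in Abel's identity.
  rw [outcomeCount_eq_sum ⟨0, by simp⟩, Nat.add_sub_cancel, ← sum_choose_mul_pow_mul_pow,
    ← Finset.sum_range_reflect]
  refine Finset.sum_congr rfl fun s hs => ?_
  have hs' : s ≤ n := Nat.lt_succ_iff.1 (Finset.mem_range.1 hs)
  simp only [Nat.add_sub_cancel]
  have hsplit : (Finset.range (n + 1)).erase (n - s)
      = Finset.range (n - s) ∪ (Finset.range s).map (addRightEmbedding (n - s + 1)) := by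
    ext x
    simp only [Finset.mem_erase, Finset.mem_range, Finset.mem_union, Finset.mem_map,
      addRightEmbedding_apply]
    constructor
    · intro h
      by_cases hx : x < n - s
      · exact Or.inl hx
      · exact Or.inr ⟨x - (n - s + 1), by omega, by omega⟩
    · rintro (h | ⟨y, hy, rfl⟩) <;> omega
  rw [runLength_range (by omega), hsplit,
    outcomeCount_union (s := n - s) (by simp) (by simp; omega), outcomeCount_map_add,
    ih _ (by omega), ih _ (by omega)]
  simp only [Finset.card_range, Finset.card_map]
  rw [Nat.sub_add_cancel hs', Nat.choose_symm hs']
  have : (n - s + 1) ^ (n - s) = (n - s + 1) * (n - s + 1) ^ (n - s - 1) := by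
    rcases Nat.eq_zero_or_pos (n - s) with h | h
    · simp [h]
    · rw [← pow_succ', Nat.sub_add_cancel h]
  rw [this]
  ring

/-! ### The Borel weights sum to one -/

theorem borelWeight_zero : borelWeight 0 = 0 := by simp [borelWeight]

theorem borelWeight_succ (m : ℕ) : borelWeight (m + 1) =
    Real.exp (-((m : ℝ) + 1)) * ((m : ℝ) + 1) ^ m / ((m + 1).factorial : ℝ) := by
  simp [borelWeight]

theorem borelWeight_nonneg (m : ℕ) : 0 ≤ borelWeight m := by
  unfold borelWeight
  split_ifs <;> positivity

/-- The product is `e ^ (-m)` times a single term of the series for `e ^ m`. -/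
theorem mul_borelWeight_le_one (m : ℕ) : (m : ℝ) * borelWeight m ≤ 1 := by
  rcases m with _ | m
  · simp
  have h := Real.pow_div_factorial_le_exp ((m : ℝ) + 1) (by positivity) (m + 1)
  have e : ((m + 1 : ℕ) : ℝ) * borelWeight (m + 1)
      = Real.exp (-((m : ℝ) + 1)) * (((m : ℝ) + 1) ^ (m + 1) / ((m + 1).factorial : ℝ)) := by
    rw [borelWeight_succ, pow_succ]
    push_cast
    ring
  rw [e]
  calc _ ≤ Real.exp (-((m : ℝ) + 1)) * Real.exp ((m : ℝ) + 1) := by gcongr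
    _ = 1 := by rw [← Real.exp_add]; simp

/-- Monotonicity of the Stirling sequence gives the order `1 / √m`; the weaker bound of order `1 /
m` already makes the series diverge. -/
theorem inv_le_mul_borelWeight (m : ℕ) :
    (Real.exp 1)⁻¹ * ((m + 1 : ℕ) : ℝ)⁻¹ ≤ ((m + 1 : ℕ) : ℝ) * borelWeight (m + 1) := by
  have h1 : Stirling.stirlingSeq (m + 1) ≤ Real.exp 1 / √2 := by
    rw [← Stirling.stirlingSeq_one]
    exact Stirling.stirlingSeq'_antitone (Nat.zero_le m)
  have hx : (1 : ℝ) ≤ ((m + 1 : ℕ) : ℝ) := by push_cast; linarith [m.cast_nonneg (α := ℝ)]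
  have e : ((m + 1 : ℕ) : ℝ) * borelWeight (m + 1)
      = (((m + 1 : ℕ) : ℝ) / Real.exp 1) ^ (m + 1) / ((m + 1).factorial : ℝ) := by
    rw [borelWeight_succ, div_pow, ← Real.exp_nat_mul, Real.exp_neg, pow_succ]
    push_cast
    field_simp
  rw [e]
  generalize hX : ((m + 1 : ℕ) : ℝ) = x at *
  have hx0 : 0 < x := by linarith
  have hf : (0 : ℝ) < ((m + 1).factorial : ℝ) := by positivity
  rw [Stirling.stirlingSeq, hX, Real.sqrt_mul (by norm_num), div_le_div_iff₀ (by positivity)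
    (by positivity)] at h1
  have h2 : ((m + 1).factorial : ℝ) ≤ Real.exp 1 * √x * (x / Real.exp 1) ^ (m + 1) := by
    have h3 : (0 : ℝ) < √2 := by positivity
    refine le_of_mul_le_mul_right ?_ h3
    linarith
  have h4 : √x ≤ x := by
    rw [Real.sqrt_le_left hx0.le]
    nlinarith
  rw [le_div_iff₀ hf, ← mul_inv, inv_mul_le_iff₀ (by positivity)]
  calc _ ≤ _ := h2
    _ ≤ _ := by gcongr

theorem tendsto_sum_mul_borelWeight :
    Tendsto (fun N => ∑ k ∈ Finset.range N, (k : ℝ) * borelWeight k) atTop atTop := by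
  rw [← not_summable_iff_tendsto_nat_atTop_of_nonneg
    fun k => mul_nonneg k.cast_nonneg (borelWeight_nonneg k)]
  intro h
  have h1 := (summable_nat_add_iff 1).2 h
  have h2 : Summable fun m : ℕ => (Real.exp 1)⁻¹ * ((m + 1 : ℕ) : ℝ)⁻¹ :=
    Summable.of_nonneg_of_le (fun m => by positivity) inv_le_mul_borelWeight h1
  rw [summable_mul_left_iff (by positivity)] at h2
  exact Real.not_summable_natCast_inv ((summable_nat_add_iff 1).1 h2)

/-- The convolution identity for the Borel weights, a form of Abel's identity. -/
theorem sum_mul_borelWeight_mul_borelWeight (N : ℕ) :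
    ∑ k ∈ Finset.range (N + 1), (k : ℝ) * borelWeight k * borelWeight (N + 1 - k)
      = (N : ℝ) * borelWeight (N + 1) := by
  rw [Finset.sum_range_succ']
  rcases N with _ | n
  · simp
  have key : ∀ k ∈ Finset.range (n + 1),
      ((n + 1 - 1 - k + 1 : ℕ) : ℝ) * borelWeight (n + 1 - 1 - k + 1) *
        borelWeight (n + 1 + 1 - (n + 1 - 1 - k + 1))
      = Real.exp (-((n : ℝ) + 2)) / (n.factorial : ℝ) *
        ((n.choose k * (k + 1) ^ (k - 1) * (n - k + 1) ^ (n - k) : ℕ) : ℝ) := by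
    intro k hk
    have hk' : k ≤ n := Nat.lt_succ_iff.1 (Finset.mem_range.1 hk)
    obtain ⟨i, rfl⟩ := Nat.exists_eq_add_of_le hk'
    rw [show k + i + 1 - 1 - k = i by omega, show k + i + 1 + 1 - (i + 1) = k + 1 by omega,
      show k + i - k = i by omega, borelWeight_succ, borelWeight_succ,
      show -(((k + i : ℕ) : ℝ) + 2) = -((i : ℝ) + 1) + -((k : ℝ) + 1) by push_cast; ring,
      Real.exp_add]
    have hc : ((k + i).choose k : ℝ) * (k.factorial : ℝ) * (i.factorial : ℝ)
        = ((k + i).factorial : ℝ) := by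
      have := Nat.choose_mul_factorial_mul_factorial (Nat.le_add_right k i)
      rw [Nat.add_sub_cancel_left] at this
      exact_mod_cast this
    have hkp : ((k : ℝ) + 1) ^ k = ((k : ℝ) + 1) ^ (k - 1) * ((k : ℝ) + 1) := by
      rcases k with _ | k
      · simp
      · rw [Nat.add_sub_cancel, pow_succ]
    rw [← hc, Nat.factorial_succ, Nat.factorial_succ]
    push_cast
    rw [hkp]
    have : ((k + i).choose k : ℝ) ≠ 0 := by
      exact_mod_cast (Nat.choose_pos (Nat.le_add_right k i)).ne'
    field_simp
  rw [← Finset.sum_range_reflect, Finset.sum_congr rfl key, ← Finset.mul_sum, ← Nat.cast_sum,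
    sum_choose_mul_pow_mul_pow, borelWeight_succ, Nat.factorial_succ, Nat.factorial_succ]
  push_cast
  rw [show -((n : ℝ) + 1 + 1) = -((n : ℝ) + 2) by ring, show (n : ℝ) + 1 + 1 = n + 2 by ring,
    pow_succ]
  field_simp
  simp

/-- With `b = borelWeight` and `u k = k * b k`, the convolution identity reads `u * b = u - b`. This
is its summed form, a renewal equation in which the truncated tails of `b` are weighted by the
divergent series of `u`. -/
theorem sum_mul_borelWeight_mul_one_sub (N : ℕ) :
    ∑ k ∈ Finset.range (N + 1), (k : ℝ) * borelWeight k *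
      (1 - ∑ m ∈ Finset.range (N + 1 - k), borelWeight m)
      = ∑ k ∈ Finset.range (N + 1), borelWeight k := by
  induction N with
  | zero => simp [borelWeight_zero]
  | succ N ih =>
    have h : ∀ k ∈ Finset.range (N + 1), (k : ℝ) * borelWeight k *
        (1 - ∑ m ∈ Finset.range (N + 1 + 1 - k), borelWeight m)
        = (k : ℝ) * borelWeight k * (1 - ∑ m ∈ Finset.range (N + 1 - k), borelWeight m)
          - (k : ℝ) * borelWeight k * borelWeight (N + 1 - k) := by
      intro k hk
      have hk' : k ≤ N := Nat.lt_succ_iff.1 (Finset.mem_range.1 hk)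
      rw [show N + 1 + 1 - k = (N + 1 - k) + 1 by omega, Finset.sum_range_succ]
      ring
    rw [Finset.sum_range_succ, Finset.sum_congr rfl h, Finset.sum_sub_distrib, ih,
      sum_mul_borelWeight_mul_borelWeight, Finset.sum_range_succ _ (N + 1)]
    simp [borelWeight_zero]
    ring

theorem sum_range_borelWeight_le_one (M : ℕ) : ∑ m ∈ Finset.range M, borelWeight m ≤ 1 := by
  by_contra! hM
  set B : ℕ → ℝ := fun N => ∑ m ∈ Finset.range N, borelWeight m with hB
  have hBmono : Monotone B := fun a b hab => Finset.sum_le_sum_of_subset_of_nonneg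
    (Finset.range_mono hab) fun _ _ _ => borelWeight_nonneg _
  have hB0 : ∀ N, 0 ≤ B N := fun N => Finset.sum_nonneg fun _ _ => borelWeight_nonneg _
  have hkb : ∀ k : ℕ, 0 ≤ (k : ℝ) * borelWeight k :=
    fun k => mul_nonneg k.cast_nonneg (borelWeight_nonneg k)
  -- If `B M > 1`, the terms with `k < L` carry a factor at most `1 - B M < 0`, and the remaining `M
  -- + 1` terms are at most `1` each. As the total is nonnegative, the partial sums of `k *
  -- borelWeight k` would be bounded.
  have key : ∀ L : ℕ, (B M - 1) * ∑ k ∈ Finset.range L, (k : ℝ) * borelWeight k ≤ M + 1 := by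
    intro L
    have h := sum_mul_borelWeight_mul_one_sub (L + M)
    rw [show L + M + 1 = L + (M + 1) by ring, Finset.sum_range_add] at h
    have h1 : ∑ k ∈ Finset.range L, (k : ℝ) * borelWeight k * (1 - B (L + (M + 1) - k))
        ≤ ∑ k ∈ Finset.range L, (k : ℝ) * borelWeight k * (1 - B M) := by
      refine Finset.sum_le_sum fun k hk => mul_le_mul_of_nonneg_left ?_ (hkb k)
      have := hBmono (show M ≤ L + (M + 1) - k by have := Finset.mem_range.1 hk; omega)
      linarith
    have h2 : ∑ k ∈ Finset.range (M + 1), ((L + k : ℕ) : ℝ) * borelWeight (L + k) *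
        (1 - B (L + (M + 1) - (L + k))) ≤ ∑ k ∈ Finset.range (M + 1), (1 : ℝ) := by
      refine Finset.sum_le_sum fun k _ => ?_
      have h3 := mul_borelWeight_le_one (L + k)
      have h4 := hkb (L + k)
      have h5 := hB0 (L + (M + 1) - (L + k))
      nlinarith
    have h6 := hB0 (L + (M + 1))
    rw [← Finset.sum_mul] at h1
    simp only [Finset.sum_const, Finset.card_range, nsmul_eq_mul, mul_one] at h2
    push_cast at h2 h
    simp only [hB] at *
    linarith
  obtain ⟨L, hL⟩ := (tendsto_sum_mul_borelWeight.eventually_gt_atTop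
    (((M : ℝ) + 1) / (B M - 1))).exists
  rw [div_lt_iff₀ (by simpa [hB] using hM)] at hL
  have := key L
  linarith

theorem hasSum_borelWeight : HasSum borelWeight 1 := by
  have hsum : Summable borelWeight :=
    summable_of_sum_range_le borelWeight_nonneg sum_range_borelWeight_le_one
  have hle : ∑' m, borelWeight m ≤ 1 :=
    hsum.tsum_le_of_sum_range_le sum_range_borelWeight_le_one
  have hge : 1 ≤ ∑' m, borelWeight m := by
    -- If the total were `q < 1`, every tail would be at least `1 - q`, so divergence of `∑ k *
    -- borelWeight k` would make the left side of the renewal equation exceed `1`.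
    by_contra! hlt
    set q := ∑' m, borelWeight m
    obtain ⟨N, hN⟩ := ((tendsto_add_atTop_iff_nat 1).2
      tendsto_sum_mul_borelWeight |>.eventually_gt_atTop (1 / (1 - q))).exists
    rw [div_lt_iff₀ (by linarith)] at hN
    have h1 := sum_mul_borelWeight_mul_one_sub N
    have h2 : (∑ k ∈ Finset.range (N + 1), (k : ℝ) * borelWeight k) * (1 - q)
        ≤ ∑ k ∈ Finset.range (N + 1), (k : ℝ) * borelWeight k *
      (1 - ∑ m ∈ Finset.range (N + 1 - k), borelWeight m) := by
      rw [Finset.sum_mul]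
      refine Finset.sum_le_sum fun k _ => mul_le_mul_of_nonneg_left ?_
        (mul_nonneg k.cast_nonneg (borelWeight_nonneg k))
      have := hsum.sum_le_tsum (Finset.range (N + 1 - k)) fun _ _ => borelWeight_nonneg _
      linarith
    have h3 := sum_range_borelWeight_le_one (N + 1)
    linarith
  rw [← le_antisymm hle hge]
  exact hsum.hasSum

instance isProbabilityMeasure_borelMeasure : IsProbabilityMeasure borelMeasure := by
  constructor
  rw [borelMeasure, Measure.sum_apply _ MeasurableSet.univ]
  simp only [Measure.smul_apply, measure_univ, smul_eq_mul, mul_one]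
  rw [← ENNReal.ofReal_tsum_of_nonneg borelWeight_nonneg hasSum_borelWeight.summable,
    hasSum_borelWeight.tsum_eq, ENNReal.ofReal_one]

theorem borelMeasure_singleton (m : ℕ) : borelMeasure {m} = ENNReal.ofReal (borelWeight m) := by
  rw [borelMeasure, Measure.sum_apply _ (measurableSet_singleton m), tsum_eq_single m]
  · simp
  · intro i hi
    simp [hi]

/-! ### The parking process -/

theorem firstFree_eq_coe_iff {n : ℕ} {V : Finset (Fin n)} {p s : Fin n} :
    firstFree V p = (s : WithTop (Fin n)) ↔
      p ≤ s ∧ s ∉ V ∧ ∀ t, p ≤ t → t < s → t ∈ V := by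
  constructor
  · intro h
    refine ⟨(firstFree_eq_coe h).1, (firstFree_eq_coe h).2, fun t hpt hts => ?_⟩
    by_contra ht
    have h1 : firstFree V p ≤ (t : WithTop (Fin n)) := Finset.min_le (by simp [hpt, ht])
    rw [h, WithTop.coe_le_coe] at h1
    exact absurd hts (not_lt.2 h1)
  · rintro ⟨h1, h2, h3⟩
    refine le_antisymm (Finset.min_le (by simp [h1, h2])) (Finset.le_min fun t ht => ?_)
    obtain ⟨ht1, ht2⟩ := (Finset.mem_filter.1 ht).2
    by_contra hlt
    exact ht2 (h3 t ht1 (by simpa using hlt))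

theorem occupied_congr {n : ℕ} {π ρ : Fin n → Fin n} {m : ℕ}
    (h : ∀ i : Fin n, (i : ℕ) < m → π i = ρ i) : occupied π m = occupied ρ m := by
  induction m with
  | zero => rfl
  | succ m ih =>
    have h1 := ih fun i hi => h i (by omega)
    ext s
    simp only [occupied, h1, Finset.mem_filter, Finset.mem_univ, true_and]
    refine or_congr_right (exists_congr fun hm => ?_)
    rw [h ⟨m, hm⟩ (Nat.lt_succ_self m)]

theorem spot_congr {n : ℕ} {π ρ : Fin n → Fin n} {k : Fin n}
    (h : ∀ i ≤ k, π i = ρ i) : spot π k = spot ρ k := by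
  rw [spot, spot, h k le_rfl, occupied_congr fun i hi => h i (Fin.le_def.2 hi.le)]

theorem occupied_succ_of_spot {n : ℕ} {π : Fin n → Fin n} {i s : Fin n}
    (h : spot π i = (s : WithTop (Fin n))) :
    occupied π (i + 1) = insert s (occupied π i) := by
  ext t
  rw [spot] at h
  simp only [occupied, Finset.mem_filter, Finset.mem_univ, true_and, Finset.mem_insert, Fin.is_lt,
    Fin.eta, exists_true_left, h, WithTop.coe_inj]
  rw [or_comm, eq_comm]

theorem occupied_succ_of_spot_eq_top {n : ℕ} {π : Fin n → Fin n} {i : Fin n}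
    (h : spot π i = ⊤) : occupied π (i + 1) = occupied π i := by
  ext t
  rw [spot] at h
  simp [occupied, h]

theorem card_occupied_le {n : ℕ} (π : Fin n → Fin n) {m : ℕ} (hm : m ≤ n) :
    (occupied π m).card ≤ m := by
  induction m with
  | zero => simp [occupied]
  | succ m ih =>
    have ih' := ih (by omega)
    cases h : spot π ⟨m, hm⟩ with
    | top => rw [occupied_succ_of_spot_eq_top (i := ⟨m, hm⟩) h]; simp only; omega
    | coe s =>
      rw [occupied_succ_of_spot (i := ⟨m, hm⟩) h]
      exact (Finset.card_insert_le _ _).trans (by simpa using ih')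

theorem card_occupied_add_le {n : ℕ} (π : Fin n → Fin n) {m k : ℕ} (hm : m + k ≤ n) :
    (occupied π (m + k)).card ≤ (occupied π m).card + k := by
  induction k with
  | zero => simp
  | succ k ih =>
    have ih' := ih (by omega)
    have hk : m + k < n := by omega
    rw [← add_assoc]
    cases h : spot π ⟨m + k, hk⟩ with
    | top => rw [occupied_succ_of_spot_eq_top (i := ⟨m + k, hk⟩) h]; simp only; omega
    | coe s =>
      rw [occupied_succ_of_spot (i := ⟨m + k, hk⟩) h]
      exact (Finset.card_insert_le _ _).trans (by simp only; omega)

theorem isParkingFunction_iff {n : ℕ} (π : Fin n → Fin n) :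
    IsParkingFunction π ↔ occupied π n = Finset.univ := by
  constructor
  · intro h
    refine Finset.eq_univ_of_forall fun s => ?_
    obtain ⟨i, rfl⟩ := (Finite.injective_iff_surjective.1 (parkedAt_injective ⟨π, h⟩)) s
    exact mem_occupied_of_spot (coe_parkedAt ⟨π, h⟩ i).symm i.2
  · intro h i hi
    -- A car that fails to park adds no space, and each other car adds at most one, so `n` spaces
    -- cannot be filled.
    have h1 := card_occupied_add_le π (m := i + 1) (k := n - (i + 1)) (by omega)
    rw [show (i : ℕ) + 1 + (n - (i + 1)) = n by omega, h, Finset.card_univ, Fintype.card_fin,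
      occupied_succ_of_spot_eq_top hi] at h1
    have h2 := card_occupied_le π i.2.le
    omega

/-- The preferences that lead to space `u` when the occupied spaces are those in `U.erase u`. -/
def goodPrefs {n : ℕ} (U : Finset (Fin n)) (u : Fin n) : Finset (Fin n) :=
  Finset.univ.filter fun p => p ≤ u ∧ ∀ t, p ≤ t → t ≤ u → t ∈ U

theorem firstFree_erase_eq_iff {n : ℕ} {U : Finset (Fin n)} {u p : Fin n} (hu : u ∈ U) :
    firstFree (U.erase u) p = (u : WithTop (Fin n)) ↔ p ∈ goodPrefs U u := by
  rw [firstFree_eq_coe_iff]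
  simp only [goodPrefs, Finset.mem_filter, Finset.mem_univ, true_and, Finset.mem_erase]
  constructor
  · rintro ⟨h1, -, h3⟩
    refine ⟨h1, fun t ht1 ht2 => ?_⟩
    rcases ht2.lt_or_eq with h | rfl
    · exact (h3 t ht1 h).2
    · exact hu
  · rintro ⟨h1, h2⟩
    exact ⟨h1, by simp, fun t ht1 ht2 => ⟨ht2.ne, h2 t ht1 ht2.le⟩⟩

theorem card_goodPrefs {n : ℕ} (U : Finset (Fin n)) (u : Fin n) :
    (goodPrefs U u).card = runLength (U.map Fin.valEmbedding) u := by
  unfold runLength goodPrefs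
  refine Finset.card_bij (fun p _ => (p : ℕ)) ?_ (fun p _ q _ h => Fin.ext h) ?_
  · intro p hp
    obtain ⟨h1, h2⟩ := (Finset.mem_filter.1 hp).2
    refine Finset.mem_filter.2 ⟨Finset.mem_range.2 (Nat.lt_succ_of_le h1), fun x hx => ?_⟩
    rw [Finset.mem_Icc] at hx
    exact Finset.mem_map.2 ⟨⟨x, by omega⟩, h2 _ (Fin.le_def.2 hx.1) (Fin.le_def.2 hx.2), rfl⟩
  · intro q hq
    obtain ⟨h1, h2⟩ := Finset.mem_filter.1 hq
    rw [Finset.mem_range] at h1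
    refine ⟨⟨q, by omega⟩, Finset.mem_filter.2 ⟨Finset.mem_univ _,
      Fin.le_def.2 (by simp only; omega), fun t ht1 ht2 => ?_⟩, rfl⟩
    obtain ⟨t', ht', h⟩ := Finset.mem_map.1
      (h2 (Finset.mem_Icc.2 ⟨Fin.le_def.1 ht1, Fin.le_def.1 ht2⟩))
    rwa [← Fin.val_injective h]

/-- The cardinality of `U` forces all of the first `m + 1` cars to park; `u` is the space taken by
the last of them. -/
theorem occupied_succ_eq_iff {n m : ℕ} (hm : m < n) {U : Finset (Fin n)} (hU : U.card = m + 1)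
    (π : Fin n → Fin n) : occupied π (m + 1) = U ↔
      ∃ u ∈ U, occupied π m = U.erase u ∧ π ⟨m, hm⟩ ∈ goodPrefs U u := by
  constructor
  · intro h
    cases hs : spot π ⟨m, hm⟩ with
    | top =>
      have h1 := occupied_succ_of_spot_eq_top hs
      have h2 := card_occupied_le π hm.le
      simp only [h] at h1
      rw [← h1] at h2
      omega
    | coe s =>
      have h1 := occupied_succ_of_spot hs
      simp only [h] at h1
      have h2 : s ∉ occupied π m := (firstFree_eq_coe hs).2
      have hsU : s ∈ U := by rw [h1]; exact Finset.mem_insert_self _ _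
      have h3 : occupied π m = U.erase s := by rw [h1, Finset.erase_insert h2]
      refine ⟨s, hsU, h3, ?_⟩
      rw [← firstFree_erase_eq_iff hsU, ← h3]
      exact hs
  · rintro ⟨u, hu, h1, h2⟩
    rw [← firstFree_erase_eq_iff hu, ← h1] at h2
    have h3 := occupied_succ_of_spot (i := ⟨m, hm⟩) h2
    simp only at h3
    rw [h3, h1, Finset.insert_erase hu]

/-! ### Counting preference functions -/

/-- A condition that ignores coordinate `i` is independent of that coordinate: exchanging `π i` with
the spare value `p` is a bijection and its own inverse. -/
theorem card_filter_and_mem_mul {ι α : Type*} [Fintype ι] [DecidableEq ι] [Fintype α]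
    [DecidableEq α] (D : (ι → α) → Prop) [DecidablePred D] (i : ι)
    (hD : ∀ π p, D (Function.update π i p) ↔ D π) (S : Finset α) :
    (Finset.univ.filter fun π => D π ∧ π i ∈ S).card * Fintype.card α
      = (Finset.univ.filter D).card * S.card := by
  rw [← Finset.card_univ, ← Finset.card_product, ← Finset.card_product]
  refine Finset.card_nbij' (fun x => (Function.update x.1 i x.2, x.1 i))
    (fun x => (Function.update x.1 i x.2, x.1 i)) ?_ ?_ ?_ ?_
  · rintro ⟨π, p⟩ h
    simpa [hD] using h
  · rintro ⟨π, p⟩ h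
    simpa [hD] using h
  · rintro ⟨π, p⟩ h
    simp
  · rintro ⟨π, p⟩ h
    simp

theorem occupied_update {n m : ℕ} (π : Fin n → Fin n) {i : Fin n} (hi : m ≤ i) (p : Fin n) :
    occupied (Function.update π i p) m = occupied π m := by
  refine occupied_congr fun k hk => Function.update_of_ne ?_ _ _
  rintro rfl
  omega

/-- The preferences of the other `n - m` cars are arbitrary. Multiplying by `n ^ m` expresses this
without the exponent `n - m`, and conditioning on the space of the last car reproduces the recursion
for `outcomeCount`. -/
theorem card_occupied_eq_mul_pow {n m : ℕ} (hm : m ≤ n) {U : Finset (Fin n)} (hU : U.card = m) :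
    (Finset.univ.filter fun π : Fin n → Fin n => occupied π m = U).card * n ^ m
      = outcomeCount (U.map Fin.valEmbedding) * n ^ n := by
  induction m generalizing U with
  | zero =>
    rw [Finset.card_eq_zero] at hU
    subst hU
    simp [occupied]
  | succ m ih =>
    have hm' : m < n := hm
    have hset : (Finset.univ.filter fun π : Fin n → Fin n => occupied π (m + 1) = U)
        = U.biUnion fun u => Finset.univ.filter fun π : Fin n → Fin n =>
          occupied π m = U.erase u ∧ π ⟨m, hm'⟩ ∈ goodPrefs U u := by
      ext π
      simp [occupied_succ_eq_iff hm' hU]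
    have hne : U.Nonempty := Finset.card_pos.1 (by omega)
    rw [hset, Finset.card_biUnion, pow_succ', ← mul_assoc, Finset.sum_mul, Finset.sum_mul,
      outcomeCount_eq_sum hne.map, Finset.sum_map, Finset.sum_mul]
    · refine Finset.sum_congr rfl fun u hu => ?_
      have h := card_filter_and_mem_mul (fun π : Fin n → Fin n => occupied π m = U.erase u)
        ⟨m, hm'⟩ (fun π p => by rw [occupied_update π le_rfl]) (goodPrefs U u)
      rw [Fintype.card_fin, card_goodPrefs] at h
      rw [h, ← Finset.map_erase, mul_right_comm,
        ih hm'.le (by rw [Finset.card_erase_of_mem hu, hU]; rfl)]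
      simp only [Fin.valEmbedding_apply]
      ring
    · intro u hu v hv huv
      refine Finset.disjoint_left.2 fun π h1 h2 => huv ?_
      have h1' := (Finset.mem_filter.1 h1).2.1
      have h2' := (Finset.mem_filter.1 h2).2.1
      exact (Finset.erase_inj U hu).1 (h1'.symm.trans h2')

theorem map_univ_valEmbedding (n : ℕ) :
    (Finset.univ : Finset (Fin n)).map Fin.valEmbedding = Finset.range n := by
  ext x
  simp only [Finset.mem_map, Finset.mem_univ, true_and, Finset.mem_range, Fin.valEmbedding_apply]
  exact ⟨fun ⟨a, ha⟩ => ha ▸ a.2, fun h => ⟨⟨x, h⟩, rfl⟩⟩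

theorem pow_self_pos (n : ℕ) : 0 < n ^ n := by
  rcases n with _ | n
  · simp
  · positivity

theorem card_parkingFunction (n : ℕ) :
    Fintype.card (ParkingFunction n) = (n + 1) ^ (n - 1) := by
  have h := card_occupied_eq_mul_pow (n := n) le_rfl (Finset.card_fin n)
  rw [map_univ_valEmbedding, outcomeCount_range] at h
  rw [← Nat.eq_of_mul_eq_mul_right (pow_self_pos n) h]
  exact Fintype.card_of_subtype _ fun π => by simp [isParkingFunction_iff]

/-! ### The last cars -/

/-- After the arrival of all but the last `j` cars, exactly the spaces `e 0, …, e (j - 1)` are free,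
and the first `l` of the last cars park there in this order. -/
def FillsInOrder {j n : ℕ} (h : j ≤ n) (e : Fin j → Fin n) (l : ℕ) (π : Fin n → Fin n) : Prop :=
  occupied π (n - j) = (Finset.univ.image e)ᶜ ∧
    ∀ i : Fin j, (i : ℕ) < l → spot π (lastCar h i) = (e i : WithTop (Fin n))

theorem FillsInOrder.mem_occupied_iff {j n : ℕ} {h : j ≤ n} {e : Fin j → Fin n} {l : ℕ}
    {π : Fin n → Fin n} (he : StrictMono e) (hπ : FillsInOrder h e l π) (hl : l ≤ j) (s : Fin n) :
    s ∈ occupied π (n - j + l) ↔ ∀ i : Fin j, l ≤ i → s ≠ e i := by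
  induction l with
  | zero =>
    rw [add_zero, hπ.1]
    simp [eq_comm]
  | succ l ih =>
    have ih' := ih ⟨hπ.1, fun i hi => hπ.2 i (by omega)⟩ (by omega)
    have h1 := occupied_succ_of_spot (hπ.2 ⟨l, hl⟩ (Nat.lt_succ_self l))
    simp only [lastCar] at h1
    rw [← add_assoc, h1, Finset.mem_insert, ih']
    constructor
    · rintro (rfl | h2) i hi
      · exact fun h3 => absurd (Fin.ext_iff.1 (he.injective h3)) (by simp only; omega)
      · exact h2 i (by omega)
    · intro h2
      by_cases hs : s = e ⟨l, hl⟩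
      · exact Or.inl hs
      · refine Or.inr fun i hi => ?_
        rcases hi.eq_or_lt with h3 | h3
        · have : i = ⟨l, hl⟩ := Fin.ext h3.symm
          rwa [this]
        · exact h2 i h3

/-- By monotonicity of `e`, the free spaces are `e l < e (l + 1) < …`, so everything below `e l` is
occupied and a preference leads to `e l` exactly when it does not exceed it. -/
theorem fillsInOrder_succ_iff {j n : ℕ} {h : j ≤ n} {e : Fin j → Fin n} {l : ℕ}
    {π : Fin n → Fin n} (he : StrictMono e) (hl : l < j) :
    FillsInOrder h e (l + 1) π ↔
      FillsInOrder h e l π ∧ π (lastCar h ⟨l, hl⟩) ∈ Finset.Iic (e ⟨l, hl⟩) := by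
  have key : FillsInOrder h e l π → (spot π (lastCar h ⟨l, hl⟩) = (e ⟨l, hl⟩ : WithTop (Fin n)) ↔
      π (lastCar h ⟨l, hl⟩) ≤ e ⟨l, hl⟩) := by
    intro hπ
    have hocc := hπ.mem_occupied_iff he hl.le
    rw [spot, firstFree_eq_coe_iff]
    refine ⟨fun h1 => h1.1, fun h1 => ⟨h1, ?_, fun t _ ht => ?_⟩⟩
    · exact fun h2 => (hocc _).1 h2 ⟨l, hl⟩ le_rfl rfl
    · refine (hocc t).2 fun i hi h3 => ?_
      have := he.monotone (show (⟨l, hl⟩ : Fin j) ≤ i from hi)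
      rw [← h3] at this
      exact absurd ht (not_lt.2 this)
  rw [Finset.mem_Iic]
  constructor
  · intro hπ
    have h1 : FillsInOrder h e l π := ⟨hπ.1, fun i hi => hπ.2 i (by omega)⟩
    exact ⟨h1, (key h1).1 (hπ.2 _ (Nat.lt_succ_self l))⟩
  · rintro ⟨hπ, h1⟩
    refine ⟨hπ.1, fun i hi => ?_⟩
    rcases (Nat.lt_succ_iff.1 hi).lt_or_eq with h2 | h2
    · exact hπ.2 i h2
    · have : i = ⟨l, hl⟩ := Fin.ext h2
      rw [this]
      exact (key hπ).2 h1

theorem fillsInOrder_update_iff {j n : ℕ} {h : j ≤ n} {e : Fin j → Fin n} {l : ℕ} (hl : l < j)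
    (π : Fin n → Fin n) (p : Fin n) :
    FillsInOrder h e l (Function.update π (lastCar h ⟨l, hl⟩) p) ↔ FillsInOrder h e l π := by
  unfold FillsInOrder
  rw [occupied_update π (by simp [lastCar])]
  refine and_congr_right fun _ => forall_congr' fun i => imp_congr_right fun hi => ?_
  rw [spot_congr (π := Function.update π (lastCar h ⟨l, hl⟩) p) (ρ := π)]
  intro k hk
  refine Function.update_of_ne ?_ _ _
  rintro rfl
  have := Fin.le_def.1 hk
  simp only [lastCar] at this
  omega

open scoped Classical in
theorem card_fillsInOrder_mul_pow {j n : ℕ} (h : j ≤ n) {e : Fin j → Fin n} (he : StrictMono e)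
    {l : ℕ} (hl : l ≤ j) :
    (Finset.univ.filter (FillsInOrder h e l)).card * n ^ l
      = (Finset.univ.filter (FillsInOrder h e 0)).card *
        ∏ i : Fin j, if (i : ℕ) < l then (e i : ℕ) + 1 else 1 := by
  induction l with
  | zero => simp
  | succ l ih =>
    have hl' : l < j := hl
    have h1 := card_filter_and_mem_mul (FillsInOrder h e l) (lastCar h ⟨l, hl'⟩)
      (fillsInOrder_update_iff hl') (Finset.Iic (e ⟨l, hl'⟩))
    simp only [← fillsInOrder_succ_iff he hl', Fintype.card_fin, Fin.card_Iic] at h1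
    have h2 : (∏ i : Fin j, if (i : ℕ) < l + 1 then (e i : ℕ) + 1 else 1)
        = (∏ i : Fin j, if (i : ℕ) < l then (e i : ℕ) + 1 else 1) * ((e ⟨l, hl'⟩ : ℕ) + 1) := by
      have h3 : ((e ⟨l, hl'⟩ : ℕ) + 1)
          = ∏ i : Fin j, if i = ⟨l, hl'⟩ then (e i : ℕ) + 1 else 1 := by simp
      rw [h3, ← Finset.prod_mul_distrib]
      refine Finset.prod_congr rfl fun i _ => ?_
      simp only [Fin.ext_iff]
      by_cases h4 : (i : ℕ) < l
      · simp [h4, h4.ne, Nat.lt_succ_of_lt h4]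
      · by_cases h5 : (i : ℕ) = l
        · simp [h5]
        · have : ¬ (i : ℕ) < l + 1 := by omega
          simp [h4, h5, this]
    rw [h2, ← mul_assoc, ← ih hl'.le, pow_succ', ← mul_assoc, h1]
    ring

open scoped Classical in
theorem card_fillsInOrder {j n : ℕ} (h : j ≤ n) {e : Fin j → Fin n} (he : StrictMono e) :
    (Finset.univ.filter (FillsInOrder h e j)).card
      = outcomeCount ((Finset.univ.image e)ᶜ.map Fin.valEmbedding) *
        ∏ i : Fin j, ((e i : ℕ) + 1) := by
  have h1 := card_fillsInOrder_mul_pow h he le_rfl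
  have h2 : (Finset.univ.filter (FillsInOrder h e 0)).card * n ^ (n - j)
      = outcomeCount ((Finset.univ.image e)ᶜ.map Fin.valEmbedding) * n ^ n := by
    rw [← card_occupied_eq_mul_pow (Nat.sub_le n j)
      (by rw [Finset.card_compl, Finset.card_image_of_injective _ he.injective]; simp)]
    congr 2
    ext π
    simp [FillsInOrder]
  simp only [Fin.is_lt, if_true] at h1
  refine Nat.eq_of_mul_eq_mul_right (pow_self_pos n) ?_
  calc _ = (Finset.univ.filter (FillsInOrder h e j)).card * n ^ j * n ^ (n - j) := by
        rw [mul_assoc, ← pow_add, Nat.add_sub_cancel' h]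
    _ = (Finset.univ.filter (FillsInOrder h e 0)).card * n ^ (n - j) *
        ∏ i : Fin j, ((e i : ℕ) + 1) := by rw [h1]; ring
    _ = _ := by rw [h2]; ring

open scoped Classical in
-- Only this inclusion is needed, since lower bounds on the probabilities suffice.
theorem card_fillsInOrder_le {j n : ℕ} (h : j ≤ n) {e : Fin j → Fin n} (he : StrictMono e) :
    (Finset.univ.filter (FillsInOrder h e j)).card ≤
      (Finset.univ.filter fun π : ParkingFunction n =>
        ∀ l, parkedAt π (lastCar h l) = e l).card := by
  have hpf : ∀ π, FillsInOrder h e j π → IsParkingFunction π := by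
    intro π hπ
    rw [isParkingFunction_iff]
    refine Finset.eq_univ_of_forall fun s => ?_
    have := (hπ.mem_occupied_iff he le_rfl s).2 fun i hi => absurd i.2 (not_lt.2 hi)
    rwa [Nat.sub_add_cancel h] at this
  rw [← Finset.card_map (Function.Embedding.subtype IsParkingFunction)]
  refine Finset.card_le_card fun π hπ => ?_
  have hfill := (Finset.mem_filter.1 hπ).2
  refine Finset.mem_map.2
    ⟨⟨π, hpf π hfill⟩, Finset.mem_filter.2 ⟨Finset.mem_univ _, fun l => ?_⟩, rfl⟩
  rw [← WithTop.coe_inj, coe_parkedAt]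
  exact hfill.2 l l.2

/-- A lower bound for the probability of given final positions of the last cars. -/
theorem le_parkMeasure {j n : ℕ} (h : j ≤ n) {e : Fin j → Fin n} (he : StrictMono e) :
    ENNReal.ofReal ((outcomeCount ((Finset.univ.image e)ᶜ.map Fin.valEmbedding) *
        ∏ i : Fin j, ((e i : ℝ) + 1)) / ((n : ℝ) + 1) ^ (n - 1))
      ≤ parkMeasure n {σ | ∀ l, position σ (lastCar h l) = e l + 1} := by
  classical
  have hset : parkPerm ⁻¹' {σ : Equiv.Perm (Fin n) | ∀ l, position σ (lastCar h l) = e l + 1}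
      = ((Finset.univ.filter fun π : ParkingFunction n =>
        ∀ l, parkedAt π (lastCar h l) = e l : Finset (ParkingFunction n)) :
          Set (ParkingFunction n)) := by
    ext π
    simp only [Set.mem_preimage, Set.mem_ofPred_eq, Finset.coe_filter, Finset.mem_univ, true_and]
    refine forall_congr' fun l => ?_
    have : (parkPerm π)⁻¹ (lastCar h l) = parkedAt π (lastCar h l) := by
      simp [parkPerm, Equiv.Perm.inv_def]
    rw [position, this, Nat.add_right_cancel_iff, Fin.val_inj]
  rw [parkMeasure, PMF.toMeasure_apply_eq_toOuterMeasure, PMF.toOuterMeasure_map_apply, hset,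
    PMF.toOuterMeasure_apply_finset]
  simp only [PMF.uniformOfFintype_apply, Finset.sum_const, nsmul_eq_mul, card_parkingFunction]
  rw [ENNReal.ofReal_div_of_pos (by positivity), ENNReal.div_eq_inv_mul, mul_comm]
  have h1 : ENNReal.ofReal (((n : ℝ) + 1) ^ (n - 1)) = (((n + 1) ^ (n - 1) : ℕ) : ENNReal) := by
    rw [← ENNReal.ofReal_natCast]
    push_cast
    rfl
  rw [h1]
  gcongr
  refine le_trans ?_ (Nat.cast_le.2 (card_fillsInOrder_le h he))
  rw [card_fillsInOrder h he, ← ENNReal.ofReal_natCast]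
  push_cast
  rfl

/-! ### The number of outcomes with prescribed free spaces -/

/-- Division by the factorial of the number of cars absorbs the binomial coefficient, so the
normalised count is multiplicative over blocks. -/
theorem outcomeCount_union_div_factorial {U V : Finset ℕ} {s : ℕ} (hU : ∀ u ∈ U, u < s)
    (hV : ∀ v ∈ V, s < v) :
    (outcomeCount (U ∪ V) : ℝ) / ((U ∪ V).card.factorial : ℝ)
      = (outcomeCount U : ℝ) / (U.card.factorial : ℝ) *
        ((outcomeCount V : ℝ) / (V.card.factorial : ℝ)) := by
  have hdisj : Disjoint U V := Finset.disjoint_left.2 fun x h1 h2 =>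
    lt_asymm (hU x h1) (hV x h2)
  have hc := Nat.choose_mul_factorial_mul_factorial (Nat.le_add_right U.card V.card)
  rw [Nat.add_sub_cancel_left] at hc
  have hpos : ((U.card + V.card).choose U.card : ℝ) ≠ 0 := by
    exact_mod_cast (Nat.choose_pos (Nat.le_add_right _ _)).ne'
  rw [outcomeCount_union hU hV, Finset.card_union_of_disjoint hdisj, ← hc]
  push_cast
  field_simp

/-- The space after `k` initial ones and consecutive blocks of lengths `x 0, …, x (l - 1)`. -/
def blockStart (x : ℕ → ℕ) (k l : ℕ) : ℕ := k + ∑ r ∈ Finset.range l, x r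

theorem blockStart_succ (x : ℕ → ℕ) (k l : ℕ) :
    blockStart x k (l + 1) = blockStart x k l + x l := by
  rw [blockStart, Finset.sum_range_succ, ← add_assoc, ← blockStart]

theorem strictMono_blockStart {x : ℕ → ℕ} (hx : ∀ r, 0 < x r) (k : ℕ) :
    StrictMono (blockStart x k) :=
  strictMono_nat_of_lt_succ fun l => by rw [blockStart_succ]; have := hx l; omega

/-- The street in which exactly the first space of each block is free. -/
def blockSet (x : ℕ → ℕ) (k j : ℕ) : Finset ℕ :=
  Finset.range (blockStart x k j) \ (Finset.range j).image (blockStart x k)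

theorem card_blockSet {x : ℕ → ℕ} (hx : ∀ r, 0 < x r) (k j : ℕ) :
    (blockSet x k j).card = blockStart x k j - j := by
  rw [blockSet, Finset.card_sdiff_of_subset, Finset.card_range,
    Finset.card_image_of_injective _ (strictMono_blockStart hx k).injective, Finset.card_range]
  intro s hs
  obtain ⟨l, hl, rfl⟩ := Finset.mem_image.1 hs
  exact Finset.mem_range.2 (strictMono_blockStart hx k (Finset.mem_range.1 hl))

theorem blockSet_succ {x : ℕ → ℕ} (hx : ∀ r, 0 < x r) (k j : ℕ) :
    blockSet x k (j + 1) = blockSet x k j ∪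
      (Finset.range (x j - 1)).map (addRightEmbedding (blockStart x k j + 1)) := by
  have hs := blockStart_succ x k j
  have hxj := hx j
  ext t
  simp only [blockSet, Finset.mem_sdiff, Finset.mem_range, Finset.mem_image, Finset.mem_union,
    Finset.mem_map, addRightEmbedding_apply, not_exists, not_and]
  constructor
  · rintro ⟨h1, h2⟩
    by_cases ht : t < blockStart x k j
    · exact Or.inl ⟨ht, fun l hl => h2 l (by omega)⟩
    · have := h2 j (by omega)
      exact Or.inr ⟨t - (blockStart x k j + 1), by omega, by omega⟩
  · rintro (⟨h1, h2⟩ | ⟨a, ha, rfl⟩)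
    · refine ⟨by omega, fun l hl => ?_⟩
      rcases (Nat.lt_succ_iff.1 hl).lt_or_eq with h3 | rfl
      · exact h2 l h3
      · exact h1.ne'
    · refine ⟨by omega, fun l hl => ?_⟩
      have := (strictMono_blockStart hx k).monotone (Nat.lt_succ_iff.1 hl)
      omega

/-- Block `r` has one free space followed by a full run of `x r - 1`. For `x r = 1` the truncated
exponent is harmless because the base is `1`. -/
theorem outcomeCount_blockSet {x : ℕ → ℕ} (hx : ∀ r, 0 < x r) (k j : ℕ) :
    (outcomeCount (blockSet x k j) : ℝ) = ((blockStart x k j - j).factorial : ℝ) *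
      (((k : ℝ) + 1) ^ (k - 1) / (k.factorial : ℝ)) *
      ∏ r ∈ Finset.range j, ((x r : ℝ) ^ (x r - 1 - 1) / ((x r - 1).factorial : ℝ)) := by
  have key : (outcomeCount (blockSet x k j) : ℝ) / ((blockSet x k j).card.factorial : ℝ)
      = (((k : ℝ) + 1) ^ (k - 1) / (k.factorial : ℝ)) *
      ∏ r ∈ Finset.range j, ((x r : ℝ) ^ (x r - 1 - 1) / ((x r - 1).factorial : ℝ)) := by
    induction j with
    | zero => simp [blockSet, blockStart, outcomeCount_range]
    | succ j ih =>
      rw [blockSet_succ hx, outcomeCount_union_div_factorial (s := blockStart x k j), ih,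
        outcomeCount_map_add, outcomeCount_range, Finset.card_map, Finset.card_range,
        Finset.prod_range_succ, Nat.sub_add_cancel (hx j)]
      · push_cast
        ring
      · intro u hu
        exact Finset.mem_range.1 (Finset.mem_sdiff.1 hu).1
      · intro v hv
        obtain ⟨a, -, rfl⟩ := Finset.mem_map.1 hv
        simp only [addRightEmbedding_apply]
        omega
  rw [card_blockSet hx, div_eq_iff (by positivity)] at key
  rw [key]
  ring

/-! ### Asymptotics -/

theorem tendsto_add_div_add (a b : ℝ) :
    Tendsto (fun k : ℕ => ((k : ℝ) + a) / ((k : ℝ) + b)) atTop (𝓝 1) := by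
  have h : Tendsto (fun k : ℕ => 1 + (a - b) / ((k : ℝ) + b)) atTop (𝓝 (1 + 0)) := by
    refine tendsto_const_nhds.add (Tendsto.div_atTop tendsto_const_nhds ?_)
    exact tendsto_atTop_add_const_right _ _ tendsto_natCast_atTop_atTop
  rw [add_zero] at h
  refine h.congr' ?_
  have h2 : Tendsto (fun k : ℕ => (k : ℝ) + b) atTop atTop :=
    tendsto_atTop_add_const_right _ _ tendsto_natCast_atTop_atTop
  filter_upwards [h2.eventually_gt_atTop 0] with k hk
  field_simp
  ring

theorem tendsto_add_one_div_pow (d : ℕ) :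
    Tendsto (fun k : ℕ => (((k : ℝ) + 1) / ((k : ℝ) + (d + 1))) ^ (k - 1)) atTop
      (𝓝 (Real.exp (-(d : ℝ)))) := by
  have h1 := (tendsto_add_atTop_iff_nat 1).2 (Real.tendsto_one_add_div_pow_exp (d : ℝ))
  -- The known limit has exponent `k + 1`; the two surplus factors each tend to `1`.
  have h2 := (h1.inv₀ (Real.exp_ne_zero _)).mul ((tendsto_add_div_add ((d : ℝ) + 1) 1).pow 2)
  rw [one_pow, mul_one, ← Real.exp_neg] at h2
  refine h2.congr' ?_
  filter_upwards [eventually_ge_atTop 1] with k hk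
  obtain ⟨i, rfl⟩ := Nat.exists_eq_add_of_le' hk
  have e : 1 + (d : ℝ) / ((i + 1 + 1 : ℕ) : ℝ)
      = ((((i + 1 : ℕ) : ℝ) + 1) / (((i + 1 : ℕ) : ℝ) + (d + 1)))⁻¹ := by
    push_cast
    field_simp
    ring
  have e' : (((i + 1 : ℕ) : ℝ) + (d + 1)) / (((i + 1 : ℕ) : ℝ) + 1)
      = ((((i + 1 : ℕ) : ℝ) + 1) / (((i + 1 : ℕ) : ℝ) + (d + 1)))⁻¹ := by
    rw [inv_div]
  rw [e, e', inv_pow, inv_inv, Nat.add_sub_cancel]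
  have hne : (((i + 1 : ℕ) : ℝ) + 1) / (((i + 1 : ℕ) : ℝ) + (d + 1)) ≠ 0 := by positivity
  generalize (((i + 1 : ℕ) : ℝ) + 1) / (((i + 1 : ℕ) : ℝ) + (d + 1)) = y at *
  rw [show i + 1 + 1 = i + 2 by ring, pow_add]
  field_simp

theorem factorial_add_div_factorial (k c : ℕ) :
    ((k + c).factorial : ℝ) / (k.factorial : ℝ) = ∏ i ∈ Finset.range c, ((k : ℝ) + (i + 1)) := by
  induction c with
  | zero => simp [div_self (by positivity : (k.factorial : ℝ) ≠ 0)]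
  | succ c ih =>
    rw [Finset.prod_range_succ, ← ih, ← add_assoc, Nat.factorial_succ]
    push_cast
    ring

theorem exp_mul_eq_borelWeight {m : ℕ} (hm : 0 < m) :
    Real.exp (-(m : ℝ)) * ((m : ℝ) ^ (m - 1 - 1) / ((m - 1).factorial : ℝ)) = borelWeight m := by
  obtain ⟨m, rfl⟩ := Nat.exists_eq_add_of_le' hm
  rw [borelWeight_succ, Nat.add_sub_cancel, Nat.factorial_succ]
  rcases m with _ | m
  · simp
  · rw [Nat.add_sub_cancel, pow_succ ((_ : ℝ) + 1)]
    push_cast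
    field_simp

theorem le_blockStart {x : ℕ → ℕ} (hx : ∀ r, 0 < x r) (k j : ℕ) : k + j ≤ blockStart x k j := by
  induction j with
  | zero => simp [blockStart]
  | succ j ih =>
    have := hx j
    rw [blockStart_succ]
    omega

theorem tendsto_outcomeCount_blockSet {x : ℕ → ℕ} (hx : ∀ r, 0 < x r) (j : ℕ) :
    Tendsto (fun k : ℕ => (outcomeCount (blockSet x k j) : ℝ) *
        (∏ l ∈ Finset.range j, ((blockStart x k l : ℝ) + 1)) /
          ((blockStart x k j : ℝ) + 1) ^ (blockStart x k j - 1))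
      atTop (𝓝 (∏ r ∈ Finset.range j, borelWeight (x r))) := by
  set d := ∑ r ∈ Finset.range j, x r with hd
  have hs : ∀ k, blockStart x k j = k + d := fun k => rfl
  obtain ⟨c, hc⟩ : ∃ c, d = j + c := by
    have := le_blockStart hx 0 j
    rw [hs] at this
    exact ⟨d - j, by omega⟩
  set C := ∏ r ∈ Finset.range j, ((x r : ℝ) ^ (x r - 1 - 1) / ((x r - 1).factorial : ℝ)) with hC
  have hlim : (∏ r ∈ Finset.range j, borelWeight (x r)) = Real.exp (-(d : ℝ)) * 1 * 1 * C := by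
    rw [hC, mul_one, mul_one, hd, Nat.cast_sum, ← Finset.sum_neg_distrib, Real.exp_sum,
      ← Finset.prod_mul_distrib]
    exact Finset.prod_congr rfl fun r _ => (exp_mul_eq_borelWeight (hx r)).symm
  -- With `n = k + d` and `d = j + c`, the `n - 1` denominator factors are shared out: `k - 1` to
  -- the power giving `e ^ (-d)`, `c` to the factorial ratio and `j` to the preferences of the last
  -- cars.
  have h1 : Tendsto (fun k : ℕ => ∏ i ∈ Finset.range c,
      (((k : ℝ) + (i + 1)) / ((k : ℝ) + (d + 1)))) atTop (𝓝 1) := by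
    simpa using tendsto_finsetProd (Finset.range c)
      fun i _ => tendsto_add_div_add ((i : ℝ) + 1) ((d : ℝ) + 1)
  have h2 : Tendsto (fun k : ℕ => ∏ l ∈ Finset.range j,
      (((k : ℝ) + ((blockStart x 0 l : ℝ) + 1)) / ((k : ℝ) + (d + 1)))) atTop (𝓝 1) := by
    simpa using tendsto_finsetProd (Finset.range j)
      fun l _ => tendsto_add_div_add ((blockStart x 0 l : ℝ) + 1) ((d : ℝ) + 1)
  rw [hlim]
  refine ((((tendsto_add_one_div_pow d).mul h1).mul h2).mul_const C).congr' ?_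
  filter_upwards [eventually_ge_atTop 1] with k hk
  rw [outcomeCount_blockSet hx, hs, ← hC, Finset.prod_div_distrib, Finset.prod_div_distrib,
    Finset.prod_const, Finset.prod_const, Finset.card_range, Finset.card_range,
    ← factorial_add_div_factorial, show k + d - j = k + c by omega,
    show k + d - 1 = (k - 1) + c + j by omega, pow_add, pow_add, div_pow]
  have e : ∀ l, (blockStart x k l : ℝ) + 1 = (k : ℝ) + ((blockStart x 0 l : ℝ) + 1) := by
    intro l
    simp only [blockStart]
    push_cast
    ring
  simp only [e]
  push_cast
  rw [add_assoc (k : ℝ)]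
  have hD : (k : ℝ) + (d + 1) ≠ 0 := by positivity
  field_simp

/-! ### Convergence in distribution -/

/-- The vector of the numbers `n + 1 - σ⁻¹ i`, where `i` runs through the last `j` cars. -/
def lastCarVector {j : ℕ} (n : Set.Ici j) (σ : Equiv.Perm (Fin n)) (l : Fin j) : ℝ :=
  ((n : ℕ) : ℝ) + 1 - (position σ (lastCar n.2 l) : ℝ)

/-- The vector of the tail sums of `x`. -/
def tailSum {j : ℕ} (x : Fin j → ℕ) (l : Fin j) : ℝ := ∑ r ∈ Finset.Ici l, (x r : ℝ)

theorem sum_Ici_add_sum_range {j : ℕ} (y : ℕ → ℝ) (l : Fin j) :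
    ∑ r ∈ Finset.Ici l, y r + ∑ r ∈ Finset.range l, y r = ∑ r ∈ Finset.range j, y r := by
  have h : ∑ r ∈ Finset.Ici l, y r = ∑ r ∈ Finset.Ico (l : ℕ) j, y r := by
    refine Finset.sum_bij (fun r _ => (r : ℕ)) ?_ (fun a _ b _ h => Fin.ext h) ?_ fun _ _ => rfl
    · intro r hr
      exact Finset.mem_Ico.2 ⟨Fin.le_def.1 (Finset.mem_Ici.1 hr), r.2⟩
    · intro r hr
      rw [Finset.mem_Ico] at hr
      exact ⟨⟨r, hr.2⟩, Finset.mem_Ici.2 (Fin.le_def.2 hr.1), rfl⟩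
  rw [h, add_comm, Finset.sum_range_add_sum_Ico _ l.2.le]

theorem tailSum_eq_add {j : ℕ} (x : Fin j → ℕ) (l : Fin j) :
    tailSum x l = x l + ∑ r ∈ Finset.Ioi l, (x r : ℝ) := by
  rw [tailSum, ← Finset.Ioi_insert, Finset.sum_insert (by simp)]

theorem tailSum_injective (j : ℕ) : Function.Injective (tailSum (j := j)) := by
  intro x y hxy
  by_contra hne
  obtain ⟨l, hl⟩ := Function.ne_iff.1 hne
  -- At the largest index where `x` and `y` differ, the remaining tails agree.
  obtain ⟨m, hm, hmax⟩ := (Finset.univ.filter fun l => x l ≠ y l).exists_max_image id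
    ⟨l, by simpa using hl⟩
  have h1 := congrFun hxy m
  rw [tailSum_eq_add, tailSum_eq_add, Finset.sum_congr rfl (g := fun r => (y r : ℝ)),
    add_left_inj] at h1
  · exact (Finset.mem_filter.1 hm).2 (by exact_mod_cast h1)
  · intro r hr
    by_contra h2
    have := hmax r (Finset.mem_filter.2 ⟨Finset.mem_univ _, fun h => h2 (by rw [h])⟩)
    exact absurd (Finset.mem_Ioi.1 hr) (not_lt.2 this)

theorem strictAnti_tailSum {j : ℕ} {x : Fin j → ℕ} (hx : ∀ r, x r ≠ 0) :
    StrictAnti (tailSum x) := by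
  intro a b hab
  rw [tailSum_eq_add x a]
  have h1 : tailSum x b ≤ ∑ r ∈ Finset.Ioi a, (x r : ℝ) :=
    Finset.sum_le_sum_of_subset_of_nonneg (fun r hr => Finset.mem_Ioi.2
      (hab.trans_le (Finset.mem_Ici.1 hr))) fun _ _ _ => by positivity
  have h2 : (0 : ℝ) < x a := by exact_mod_cast Nat.pos_of_ne_zero (hx a)
  linarith

theorem le_parkMeasure_lastCarVector {j : ℕ} {x : ℕ → ℕ} (hx : ∀ r, 0 < x r) (n : Set.Ici j)
    {k : ℕ} (hk : blockStart x k j = n) :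
    ENNReal.ofReal ((outcomeCount (blockSet x k j) : ℝ) *
        (∏ l ∈ Finset.range j, ((blockStart x k l : ℝ) + 1)) /
          ((blockStart x k j : ℝ) + 1) ^ (blockStart x k j - 1))
      ≤ parkMeasure n (lastCarVector n ⁻¹' {tailSum fun r : Fin j => x r}) := by
  obtain ⟨n, hn⟩ := n
  simp only at hk
  subst hk
  have hlt : ∀ l : Fin j, blockStart x k l < blockStart x k j :=
    fun l => strictMono_blockStart hx k l.2
  set e : Fin j → Fin (blockStart x k j) := fun l => ⟨blockStart x k l, hlt l⟩ with he
  have hmono : StrictMono e := fun a b hab => strictMono_blockStart hx k hab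
  have hset : (Finset.univ.image e)ᶜ.map Fin.valEmbedding = blockSet x k j := by
    ext t
    simp only [blockSet, Finset.mem_map, Finset.mem_compl, Finset.mem_image, Finset.mem_univ,
      true_and, Finset.mem_sdiff, Finset.mem_range, Fin.valEmbedding_apply, not_exists, not_and]
    constructor
    · rintro ⟨a, ha, rfl⟩
      exact ⟨a.2, fun l hl h => ha ⟨l, hl⟩ (Fin.ext h)⟩
    · rintro ⟨h1, h2⟩
      exact ⟨⟨t, h1⟩, fun l h => h2 l l.2 (Fin.ext_iff.1 h), rfl⟩
  have hprod : ∏ i : Fin j, ((e i : ℝ) + 1)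
      = ∏ l ∈ Finset.range j, ((blockStart x k l : ℝ) + 1) :=
    Fin.prod_univ_eq_prod_range (fun l => (blockStart x k l : ℝ) + 1) j
  have h := le_parkMeasure hn hmono
  rw [hset, hprod] at h
  refine h.trans (measure_mono fun σ hσ => ?_)
  rw [Set.mem_preimage, Set.mem_singleton_iff]
  funext l
  have h1 := hσ l
  -- The distance from the `l`-th free space to the end of the street is the total length of blocks
  -- `l, …, j - 1`.
  have h2 := sum_Ici_add_sum_range (fun r => (x r : ℝ)) l
  simp only [lastCarVector, tailSum]
  rw [h1]
  simp only [he, blockStart]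
  push_cast
  linarith

theorem exists_le_parkMeasure_tendsto {j : ℕ} (x : Fin j → ℕ) :
    ∃ q : Set.Ici j → ENNReal,
      Tendsto q atTop (𝓝 (Measure.pi (fun _ : Fin j => borelMeasure) {x})) ∧
      ∀ n, q n ≤ parkMeasure n (lastCarVector n ⁻¹' {tailSum x}) := by
  have hpi : Measure.pi (fun _ : Fin j => borelMeasure) {x}
      = ENNReal.ofReal (∏ r, borelWeight (x r)) := by
    rw [Measure.pi_singleton, ENNReal.ofReal_prod_of_nonneg fun r _ => borelWeight_nonneg _]
    simp only [borelMeasure_singleton]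
  rw [hpi]
  by_cases hx : ∀ r, x r ≠ 0
  swap
  -- A zero coordinate has Borel mass zero, so the trivial bound is enough.
  · push Not at hx
    obtain ⟨r, hr⟩ := hx
    refine ⟨fun _ => 0, ?_, fun n => zero_le⟩
    rw [Finset.prod_eq_zero (Finset.mem_univ r) (by rw [hr, borelWeight_zero]), ENNReal.ofReal_zero]
    exact tendsto_const_nhds
  -- The padding value `1` only keeps all block lengths positive; indices from `j` on do not enter.
  set y : ℕ → ℕ := fun r => if h : r < j then x ⟨r, h⟩ else 1 with hy
  have hyx : (fun r : Fin j => y r) = x := by funext r; simp [hy]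
  have hypos : ∀ r, 0 < y r := by
    intro r
    simp only [hy]
    split_ifs with h
    · exact Nat.pos_of_ne_zero (hx _)
    · exact one_pos
  set d := ∑ r ∈ Finset.range j, y r with hd
  have hlim := tendsto_outcomeCount_blockSet hypos j
  set f : ℕ → ℝ := fun k : ℕ => (outcomeCount (blockSet y k j) : ℝ) *
        (∏ l ∈ Finset.range j, ((blockStart y k l : ℝ) + 1)) /
          ((blockStart y k j : ℝ) + 1) ^ (blockStart y k j - 1) with hf
  -- For `n < d` the blocks do not fit and `n - d` would truncate; these finitely many `n` do not
  -- affect the limit.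
  refine ⟨fun n => if d ≤ (n : ℕ) then ENNReal.ofReal (f (n - d)) else 0, ?_, fun n => ?_⟩
  · have hprod : ∏ r ∈ Finset.range j, borelWeight (y r) = ∏ r : Fin j, borelWeight (x r) := by
      rw [← Fin.prod_univ_eq_prod_range (fun r => borelWeight (y r)) j, ← hyx]
    rw [hprod] at hlim
    have hval : Tendsto (fun n : Set.Ici j => (n : ℕ)) atTop atTop :=
      tendsto_comp_val_Ici_atTop.2 tendsto_id
    have h1 := (ENNReal.tendsto_ofReal hlim).comp ((tendsto_sub_atTop_nat d).comp hval)
    refine h1.congr' ?_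
    filter_upwards [hval.eventually_ge_atTop d] with n hn
    simp [hn]
  · beta_reduce
    split_ifs with h
    · have h1 := le_parkMeasure_lastCarVector hypos n (k := n - d)
        (show (n - d : ℕ) + d = n by omega)
      rw [hyx] at h1
      exact h1
    · exact zero_le

theorem measurable_lastCarVector {j : ℕ} (n : Set.Ici j) : Measurable (lastCarVector n) :=
  fun _ _ => trivial

/-- This is Fatou's lemma for point masses: the limit law lives on a countable space, so its mass is
a supremum over finite sets of atoms, on each of which the lower bounds converge. Hence `G` may be
arbitrary. -/
theorem pi_borelMeasure_le_liminf {j : ℕ} (G : Set (Fin j → ℝ)) :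
    Measure.pi (fun _ : Fin j => borelMeasure) (tailSum ⁻¹' G)
      ≤ liminf (fun n : Set.Ici j => parkMeasure n (lastCarVector n ⁻¹' G)) atTop := by
  classical
  choose q hq hle using exists_le_parkMeasure_tendsto (j := j)
  set ν := Measure.pi (fun _ : Fin j => borelMeasure)
  rw [← Measure.tsum_indicator_apply_singleton ν _ (Set.to_countable _).measurableSet,
    ENNReal.tsum_eq_iSup_sum]
  refine iSup_le fun s => ?_
  set t := s.filter fun x => tailSum x ∈ G with ht
  have h1 : ∑ x ∈ s, (tailSum ⁻¹' G).indicator (fun x => ν {x}) x = ∑ x ∈ t, ν {x} := by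
    rw [ht, Finset.sum_filter]
    rfl
  have h2 : Tendsto (fun n => ∑ x ∈ t, q x n) atTop (𝓝 (∑ x ∈ t, ν {x})) :=
    tendsto_finsetSum t fun x _ => hq x
  rw [h1, ← h2.liminf_eq]
  refine liminf_le_liminf (Eventually.of_forall fun n => ?_)
  calc ∑ x ∈ t, q x n ≤ ∑ x ∈ t, parkMeasure n (lastCarVector n ⁻¹' {tailSum x}) :=
        Finset.sum_le_sum fun x _ => hle x n
    _ = parkMeasure n (⋃ x ∈ t, lastCarVector n ⁻¹' {tailSum x}) := by
        refine (measure_biUnion_finset ?_ fun x _ =>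
          measurable_lastCarVector n (measurableSet_singleton _)).symm
        intro x _ y _ hxy
        refine Set.disjoint_left.2 fun σ h3 h4 => hxy (tailSum_injective j ?_)
        exact (Set.mem_singleton_iff.1 h3).symm.trans (Set.mem_singleton_iff.1 h4)
    _ ≤ parkMeasure n (lastCarVector n ⁻¹' G) := by
        refine measure_mono (Set.iUnion₂_subset fun x hx σ hσ => ?_)
        rw [Set.mem_preimage, Set.mem_singleton_iff.1 hσ]
        exact (Finset.mem_filter.1 hx).2

theorem pi_borelMeasure_strictAnti (j : ℕ) :
    Measure.pi (fun _ : Fin j => borelMeasure) (tailSum ⁻¹' {v | StrictAnti v}) = 1 := by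
  rw [← prob_compl_eq_zero_iff (Set.to_countable _).measurableSet]
  have h : ∀ᵐ x ∂(Measure.pi fun _ : Fin j => borelMeasure), ∀ r, x r ≠ 0 := by
    rw [ae_all_iff]
    intro r
    refine (measurePreserving_eval (fun _ : Fin j => borelMeasure) r).quasiMeasurePreserving.ae
      (p := fun m => m ≠ 0) ?_
    rw [ae_iff]
    simp [borelMeasure_singleton, borelWeight_zero]
  exact h.mono fun x hx => strictAnti_tailSum hx

end Parking

end

theorem corollary1p12 (j : ℕ) :
    IsProbabilityMeasure Parking.borelMeasure ∧
    (∀ (Ω : Type*) [MeasurableSpace Ω] (P : Measure Ω) [IsProbabilityMeasure P]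
      (X : Fin j → Ω → ℕ),
      (∀ r, HasLaw (X r) Parking.borelMeasure P) → iIndepFun X P →
      TendstoInDistribution
        (fun (n : Set.Ici j) (σ : Equiv.Perm (Fin n)) (l : Fin j) =>
          ((n : ℕ) : ℝ) + 1 - (Parking.position σ (Parking.lastCar n.2 l) : ℝ))
        atTop
        (fun (ω : Ω) (l : Fin j) => ∑ r ∈ Finset.Ici l, (X r ω : ℝ))
        (fun n : Set.Ici j => Parking.parkMeasure n) P) ∧
    Tendsto
      (fun n : Set.Ici j => Parking.parkMeasure n
        {σ | StrictMono fun l : Fin j => Parking.position σ (Parking.lastCar n.2 l)})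
      atTop (𝓝 1) := by
  refine ⟨inferInstance, ?_, ?_⟩
  · intro Ω _ P _ X hX hind
    have hXm : AEMeasurable (fun ω r => X r ω) P :=
      aemeasurable_pi_lambda _ fun r => (hX r).aemeasurable
    have hlaw : P.map (fun ω r => X r ω) = Measure.pi fun _ : Fin j => Parking.borelMeasure := by
      rw [hind.map_fun_eq_pi_map fun r => (hX r).aemeasurable]
      simp only [fun r => (hX r).map_eq]
    have hts : Measurable (Parking.tailSum (j := j)) := measurable_of_countable _
    have hZ : AEMeasurable (fun (ω : Ω) (l : Fin j) => ∑ r ∈ Finset.Ici l, (X r ω : ℝ)) P :=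
      hts.comp_aemeasurable hXm
    refine ⟨fun n => (Parking.measurable_lastCarVector n).aemeasurable, hZ, ?_⟩
    -- By the portmanteau theorem, the lower bound on open sets implies weak convergence.
    refine tendsto_of_forall_isOpen_le_liminf' fun G hG => ?_
    have hlim := Parking.pi_borelMeasure_le_liminf G
    rw [← hlaw, Measure.map_apply_of_aemeasurable hXm (hts hG.measurableSet)] at hlim
    simp only [ProbabilityMeasure.coe_mk]
    rw [Measure.map_apply_of_aemeasurable hZ hG.measurableSet]
    refine hlim.trans (le_of_eq ?_)
    congr 1
    funext n
    exact (Measure.map_apply (Parking.measurable_lastCarVector n) hG.measurableSet).symm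
  -- Increasing positions mean decreasing distances `n + 1 - σ⁻¹`. The limit vector is almost surely
  -- strictly decreasing because Borel variables are positive, so the liminf bound already gives
  -- `1`.
  · have hset : ∀ n : Set.Ici j,
        {σ : Equiv.Perm (Fin n) |
          StrictMono fun l : Fin j => Parking.position σ (Parking.lastCar n.2 l)}
        = Parking.lastCarVector n ⁻¹' {v | StrictAnti v} := by
      intro n
      ext σ
      refine ⟨fun h a b hab => ?_, fun h a b hab => ?_⟩
      · have h1 : (Parking.position σ (Parking.lastCar n.2 a) : ℝ)
            < Parking.position σ (Parking.lastCar n.2 b) := by exact_mod_cast h hab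
        simp only [Parking.lastCarVector]
        linarith
      · have h1 := h hab
        simp only [Parking.lastCarVector] at h1
        have h2 : (Parking.position σ (Parking.lastCar n.2 a) : ℝ)
            < Parking.position σ (Parking.lastCar n.2 b) := by linarith
        exact_mod_cast h2
    simp only [hset]
    have hlim := Parking.pi_borelMeasure_le_liminf (j := j) {v | StrictAnti v}
    rw [Parking.pi_borelMeasure_strictAnti] at hlim
    exact tendsto_of_le_liminf_of_limsup_le hlim
      (limsup_le_of_le (by isBoundedDefault) (Eventually.of_forall fun n => prob_le_one))
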